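/- **Theorem (Sum-interconnection characterization).** Let $M=(m_{ij})\in\mathbb{R}^{n\times n}$ be a Metzler matrix (i.e. $m_{ij}\ge 0$ for all $i\ne j$) with negative diagonal elements. Its digraph $\mathcal{G}(M)$ has the vertex set $\{1,\dots,n\}$ and an edge from $j$ to $i$ whenever $m_{ij}\neq 0$. Assume that $M$ is irreducible, i.e. that $\mathcal{G}(M)$ is strongly connected. Call $M$ *Hurwitz* if all its eigenvalues have negative real part. For a square matrix $A=(a_{ij})$ with negative diagonal elements, let $\Phi_A$ be the set of simple cycles of $\mathcal{G}(A)$, that is, of directed cycles $c=(i_1,i_2,\dots,i_k,i_1)$ with $k\ge 2$ and $i_1,\dots,i_k$ pairwise distinct (self loops are not simple cycles, and cycles that differ only in the choice of the starting vertex are the same). The *sum-cycle gain* of such a cycle is $$\gamma_c=\frac{a_{i_2i_1}}{-a_{i_2i_2}}\cdot\frac{a_{i_3i_2}}{-a_{i_3i_3}}\cdots\frac{a_{i_1i_k}}{-a_{i_1i_1}}.$$ For $1\le \ell\le|\Phi_A|$ let $K^A_\ell$ be the set of all $\ell$-element subsets of $\Phi_A$ whose members pairwise have no vertex in common. The *total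 cycle gain* of $A$ is $$\gamma_A=\sum_{\ell=1}^{|\Phi_A|}\ \sum_{\{c_1,\dots,c_\ell\}\in K_\ell^A}(-1)^{\ell-1}\gamma_{c_1}\cdots\gamma_{c_\ell},$$ which is $0$ if $\Phi_A=\emptyset$. For $i\in\{1,\dots,n\}$ and $I=\{1,\dots,i\}$ let $M_I$ be the leading principal submatrix of $M$ with rows and columns in $I$. Then the following statements hold: 1. (necessary condition) if $M$ is Hurwitz, then $\gamma_c<1$ for all $c\in\Phi_M$; 2. (sufficient condition) if $\sum_{c\in\Phi_M}\gamma_c<1$, then $M$ is Hurwitz; 3. (necessary and sufficient condition) $M$ is Hurwitz if and only if $\gamma_{M_I}<1$ for all $i\in\{1,\dots,n\}$, $I=\{1,\dots,i\}$. -/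

import Mathlib

namespace MetzlerGains

/-- A real square matrix is Metzler if its off-diagonal entries are nonnegative. -/
def IsMetzler {V : Type*} (M : Matrix V V ℝ) : Prop :=
  ∀ i j, i ≠ j → 0 ≤ M i j

/-- A real square matrix is Hurwitz if all its complex eigenvalues have negative real part. -/
def IsHurwitz {V : Type*} [Fintype V] [DecidableEq V] (M : Matrix V V ℝ) : Prop :=
  ∀ z ∈ spectrum ℂ (M.map (algebraMap ℝ ℂ)), z.re < 0

/-- The digraph of a matrix: there is an edge from `j` to `i` (self loops included)
exactly when the entry `M i j` is nonzero. -/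
def digraph {V : Type*} (M : Matrix V V ℝ) : Digraph V where
  Adj j i := M i j ≠ 0

/-- Every vertex can be reached from every vertex along directed edges. -/
def IsStronglyConnected {V : Type*} (G : Digraph V) : Prop :=
  ∀ i j, Relation.ReflTransGen G.Adj i j

/-- A matrix is irreducible if its digraph is strongly connected. -/
def IsIrreducible {V : Type*} (M : Matrix V V ℝ) : Prop :=
  IsStronglyConnected (digraph M)

/-- A simple cycle `(i₁, …, i_k, i₁)` of a digraph: a cyclic sequence (a list of vertices up to
rotation) without repetitions, with at least two vertices (self loops are not simple cycles),
in which there is an edge from every vertex to the next one. -/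
structure SimpleCycle {V : Type*} (G : Digraph V) where
  /-- the cyclic sequence of vertices -/
  toCycle : Cycle V
  nodup : toCycle.Nodup
  nontrivial : toCycle.Nontrivial
  chain : toCycle.Chain G.Adj

namespace SimpleCycle

theorem toCycle_injective {V : Type*} {G : Digraph V} :
    Function.Injective (SimpleCycle.toCycle : SimpleCycle G → Cycle V) := by
  rintro ⟨c, _, _, _⟩ ⟨d, _, _, _⟩ h
  cases h
  rfl

instance instFinite {V : Type*} [Finite V] (G : Digraph V) : Finite (SimpleCycle G) := by
  classical
  have := Fintype.ofFinite V
  exact Finite.of_injective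
    (fun c : SimpleCycle G => (⟨c.toCycle, c.nodup⟩ : {s : Cycle V // s.Nodup}))
    (fun c d h => toCycle_injective (congrArg Subtype.val h))

noncomputable instance instFintype {V : Type*} [Finite V] (G : Digraph V) :
    Fintype (SimpleCycle G) :=
  Fintype.ofFinite _

/-- The set of vertices of a simple cycle. -/
def vertices {V : Type*} [DecidableEq V] {G : Digraph V} (c : SimpleCycle G) : Finset V :=
  c.toCycle.toFinset

theorem mem_vertices {V : Type*} [DecidableEq V] {G : Digraph V} (c : SimpleCycle G) (i : V) :
    i ∈ c.vertices ↔ i ∈ c.toCycle := by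
  obtain ⟨s, _, _, _⟩ := c
  induction s using Quotient.inductionOn'
  exact List.mem_toFinset

/-- The vertex that follows `i` on the simple cycle `c`. -/
def next {V : Type*} [DecidableEq V] {G : Digraph V} (c : SimpleCycle G)
    (i : {i : V // i ∈ c.vertices}) : V :=
  c.toCycle.next c.nodup i.1 ((c.mem_vertices i.1).mp i.2)

end SimpleCycle

/-- The sum-cycle gain of a simple cycle of the digraph of `M`: the product, over the edges
from a vertex `i` of the cycle to the next vertex `i'`, of `M i' i / (-M i' i')`. -/
noncomputable def cycleGain {V : Type*} [DecidableEq V] (M : Matrix V V ℝ)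
    (c : SimpleCycle (digraph M)) : ℝ :=
  ∏ i ∈ c.vertices.attach,
    M (c.next i) i.1 / (-M (c.next i) (c.next i))

open Classical in
/-- The sets of `ℓ` simple cycles, any two of which have no vertex in common. -/
noncomputable def disjointCycleSets {V : Type*} [Finite V] (G : Digraph V) (ℓ : ℕ) :
    Finset (Finset (SimpleCycle G)) :=
  {S ∈ Finset.powersetCard ℓ Finset.univ |
    ∀ c ∈ S, ∀ d ∈ S, c ≠ d → Disjoint c.vertices d.vertices}

/-- The total cycle gain: the alternating sum, over the nonempty sets of pairwise disjoint simple
cycles, of the products of the cycle gains. If there is no simple cycle, the sum is empty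
and the total cycle gain is `0`. -/
noncomputable def totalCycleGain {V : Type*} [Finite V] [DecidableEq V] (M : Matrix V V ℝ) : ℝ :=
  ∑ ℓ ∈ Finset.Icc 1 (Fintype.card (SimpleCycle (digraph M))),
    ∑ S ∈ disjointCycleSets (digraph M) ℓ, (-1) ^ (ℓ - 1) * ∏ c ∈ S, cycleGain M c

/-- The leading principal submatrix of `M` on its first `i` indices. -/
def leadingPrincipalSubmatrix {n : ℕ} (M : Matrix (Fin n) (Fin n) ℝ) (i : ℕ) (hi : i ≤ n) :
    Matrix (Fin i) (Fin i) ℝ :=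
  M.submatrix (Fin.castLE hi) (Fin.castLE hi)

end MetzlerGains

/-! The pivot is a criterion: a Metzler matrix with negative diagonal is Hurwitz iff some positive
`v` has `M v < 0` entrywise (`IsMetzler.isHurwitz_of_mulVec_neg`, `IsMetzler.exists_mulVec_neg`); to
get `v`, only nonnegative real eigenvalues need excluding. Such a `v` restricts to principal
submatrices, and around a cycle its coordinate ratios telescope, so every cycle gain is below 1
(`permGain_lt_one`).

Total gains enter through the Leibniz formula: splitting permutations into disjoint cycles and
dividing by the diagonal gives `det (-A) = ∏ (-a_ii) * (1 - γ_A)`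
(`det_neg_eq_prod_mul_one_sub_totalCycleGain`). Hence the third condition says that the leading
principal minors of `-M` are positive, and bordering builds `v` from these
(`IsMetzler.exists_mulVec_neg_of_leading_minors`). For the second, `1 - γ_A` is at least 1 minus the
sum of the cycle gains when that sum is at most 1 (`signedPairwiseSum_mem_Icc`), and passing from
`M` to `M - t I` only lowers gains, so `t I - M` is nonsingular for all `t ≥ 0`. -/

namespace MetzlerGains

/-! ### Positive vectors, Hurwitz matrices and leading minors -/

open Filter Topology

variable {V : Type*} [Fintype V] [DecidableEq V]

/-- A Metzler matrix that maps a positive vector to a negative vector is Hurwitz. -/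
theorem IsMetzler.isHurwitz_of_mulVec_neg {M : Matrix V V ℝ} (hM : IsMetzler M) {v : V → ℝ}
    (hv : ∀ i, 0 < v i) (hMv : ∀ i, M.mulVec v i < 0) : IsHurwitz M := by
  intro z hz
  have hdet : ((algebraMap ℂ (Matrix V V ℂ) z) - M.map (algebraMap ℝ ℂ)).det = 0 := by
    by_contra h
    exact hz ((Matrix.isUnit_iff_isUnit_det _).2 (isUnit_iff_ne_zero.2 h))
  obtain ⟨x, hx0, hx⟩ := Matrix.exists_mulVec_eq_zero_iff.2 hdet
  obtain ⟨k, hk⟩ := Function.ne_iff.1 hx0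
  -- Gershgorin argument in the max norm weighted by `v`: row `i` is where the eigenvector is
  -- largest.
  obtain ⟨i, -, hi⟩ := Finset.exists_max_image Finset.univ (fun i => ‖x i‖ / v i) ⟨k, Finset.mem_univ k⟩
  have hmax : ∀ j, ‖x j‖ ≤ v j * (‖x i‖ / v i) := fun j => by
    have := hi j (Finset.mem_univ j)
    rwa [div_le_iff₀ (hv j), mul_comm] at this
  have hipos : 0 < ‖x i‖ / v i := by
    have h1 := hmax k
    have h2 : 0 < ‖x k‖ := norm_pos_iff.2 hk
    exact pos_of_mul_pos_right (h2.trans_le h1) (hv k).le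
  have hxi : ‖x i‖ = v i * (‖x i‖ / v i) := by
    rw [mul_div_cancel₀ _ (hv i).ne']
  set r := ‖x i‖ / v i with hr
  have heq : (z - M i i) * x i = ∑ j ∈ Finset.univ.erase i, (M i j : ℂ) * x j := by
    have h := congrFun hx i
    rw [Matrix.sub_mulVec, Pi.sub_apply, Pi.zero_apply, sub_eq_zero, Algebra.algebraMap_eq_smul_one,
      Matrix.smul_mulVec, Matrix.one_mulVec, Pi.smul_apply, smul_eq_mul] at h
    simp only [Matrix.mulVec, dotProduct, Matrix.map_apply, Complex.coe_algebraMap] at h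
    rw [← Finset.add_sum_erase _ _ (Finset.mem_univ i)] at h
    linear_combination h
  have hneg : ∑ j ∈ Finset.univ.erase i, M i j * v j < -(M i i * v i) := by
    have h := hMv i
    simp only [Matrix.mulVec, dotProduct] at h
    rw [← Finset.add_sum_erase _ _ (Finset.mem_univ i)] at h
    linarith
  have hle : ‖z - M i i‖ * (v i * r) ≤ (∑ j ∈ Finset.univ.erase i, M i j * v j) * r := by
    rw [← hxi, ← norm_mul, heq, Finset.sum_mul]
    refine (norm_sum_le _ _).trans (Finset.sum_le_sum fun j hj => ?_)
    have hij := hM i j (Finset.ne_of_mem_erase hj).symm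
    rw [norm_mul, Complex.norm_real, Real.norm_of_nonneg hij, mul_assoc]
    exact mul_le_mul_of_nonneg_left (hmax j) hij
  have hlt : ‖z - M i i‖ * (v i * r) < -(M i i) * (v i * r) := by
    nlinarith
  have hn := lt_of_mul_lt_mul_right hlt (mul_pos (hv i) hipos).le
  have := (Complex.re_le_norm (z - M i i)).trans_lt hn
  simp only [Complex.sub_re, Complex.ofReal_re] at this
  linarith

theorem IsHurwitz.det_smul_one_sub_ne_zero {M : Matrix V V ℝ} (hM : IsHurwitz M) {t : ℝ}
    (ht : 0 ≤ t) : (t • (1 : Matrix V V ℝ) - M).det ≠ 0 := by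
  intro h
  have hz : (t : ℂ) ∈ spectrum ℂ (M.map (algebraMap ℝ ℂ)) := by
    intro hu
    have hu' := ((Matrix.isUnit_iff_isUnit_det _).1 hu).ne_zero
    apply hu'
    have : algebraMap ℂ (Matrix V V ℂ) t - M.map (algebraMap ℝ ℂ)
        = (algebraMap ℝ ℂ).mapMatrix (t • (1 : Matrix V V ℝ) - M) := by
      ext i j
      by_cases hij : i = j <;> simp [Matrix.algebraMap_matrix_apply, hij]
    rw [this, ← RingHom.map_det, h, map_zero]
  have := hM _ hz
  simp only [Complex.ofReal_re] at this
  linarith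

/-- Minimum principle: if the Metzler matrix `M` maps some positive vector to a negative vector,
then every vector that `M` maps to a nonpositive vector is nonnegative. -/
theorem IsMetzler.nonneg_of_mulVec_nonpos {M : Matrix V V ℝ} (hM : IsMetzler M) {v : V → ℝ}
    (hv : ∀ i, 0 < v i) (hMv : ∀ i, M.mulVec v i < 0) {u : V → ℝ}
    (hu : ∀ i, M.mulVec u i ≤ 0) (i : V) : 0 ≤ u i := by
  obtain ⟨k, -, hk⟩ := Finset.exists_min_image Finset.univ (fun i => u i / v i)
    ⟨i, Finset.mem_univ i⟩
  have hmin : ∀ j, (u k / v k) * v j ≤ u j := fun j => by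
    have := hk j (Finset.mem_univ j)
    rwa [le_div_iff₀ (hv j)] at this
  have huk : (u k / v k) * v k = u k := div_mul_cancel₀ _ (hv k).ne'
  set r := u k / v k
  have hle : r * M.mulVec v k ≤ M.mulVec u k := by
    simp only [Matrix.mulVec, dotProduct]
    rw [Finset.mul_sum]
    refine Finset.sum_le_sum fun j _ => ?_
    by_cases hj : k = j
    · subst hj; rw [← huk]; linarith
    · nlinarith [hM k j hj, hmin j]
  have hr : 0 ≤ r := by
    by_contra hr
    nlinarith [hMv k, hu k, mul_pos_of_neg_of_neg (not_le.1 hr) (hMv k)]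
  exact (mul_nonneg hr (hv i).le).trans (hmin i)

omit [Fintype V] in
theorem IsMetzler.sub_smul_one {M : Matrix V V ℝ} (hM : IsMetzler M) (t : ℝ) :
    IsMetzler (M - t • (1 : Matrix V V ℝ)) := by
  intro i j hij
  simpa [Matrix.one_apply, hij] using hM i j hij

theorem sub_smul_one_mulVec (M : Matrix V V ℝ) (t : ℝ) (u : V → ℝ) (i : V) :
    (M - t • (1 : Matrix V V ℝ)).mulVec u i = M.mulVec u i - t * u i := by
  simp [Matrix.sub_mulVec, Matrix.smul_mulVec]

/-- A Metzler matrix with negative diagonal and without nonnegative real eigenvalues maps some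
positive vector to a negative vector. -/
theorem IsMetzler.exists_mulVec_neg {M : Matrix V V ℝ} (hM : IsMetzler M)
    (hD : ∀ i, M i i < 0) (hdet : ∀ t : ℝ, 0 ≤ t → (t • (1 : Matrix V V ℝ) - M).det ≠ 0) :
    ∃ v : V → ℝ, (∀ i, 0 < v i) ∧ ∀ i, M.mulVec v i < 0 := by
  -- Follow the solution of `(t I - M) u = 1` from large `t`, where it is positive, down to `t = 0`,
  -- where it is the desired vector.
  let u : ℝ → V → ℝ := fun t => (t • (1 : Matrix V V ℝ) - M)⁻¹.mulVec 1
  have hu : ∀ t, 0 ≤ t → ∀ i, t * u t i - M.mulVec (u t) i = 1 := fun t ht i => by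
    have h : (t • (1 : Matrix V V ℝ) - M).mulVec (u t) = 1 := by
      rw [Matrix.mulVec_mulVec, Matrix.mul_nonsing_inv _ (isUnit_iff_ne_zero.2 (hdet t ht)),
        Matrix.one_mulVec]
    simpa [Matrix.sub_mulVec, Matrix.smul_mulVec] using congrFun h i
  have hpos : ∀ t, 0 ≤ t → (∀ i, 0 ≤ u t i) → ∀ i, 0 < u t i := fun t ht h i => by
    have h1 := hu t ht i
    simp only [Matrix.mulVec, dotProduct] at h1
    rw [← Finset.add_sum_erase _ _ (Finset.mem_univ i)] at h1
    have h2 : 0 ≤ ∑ j ∈ Finset.univ.erase i, M i j * u t j := Finset.sum_nonneg fun j hj =>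
      mul_nonneg (hM i j (Finset.ne_of_mem_erase hj).symm) (h j)
    have h3 : 0 < (t - M i i) * u t i := by linarith
    exact pos_of_mul_pos_right h3 (by linarith [hD i])
  have hcont : ContinuousOn u (Set.Ici 0) := by
    have hA : Continuous fun t : ℝ => t • (1 : Matrix V V ℝ) - M := by fun_prop
    have h1 : ContinuousOn (fun t : ℝ => (t • (1 : Matrix V V ℝ) - M)⁻¹) (Set.Ici 0) := by
      simp only [Matrix.inv_def, Ring.inverse_eq_inv']
      exact (hA.matrix_det.continuousOn.inv₀ fun t ht => hdet t ht).smul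
        hA.matrix_adjugate.continuousOn
    refine continuousOn_pi.2 fun i => ?_
    simp only [u, Matrix.mulVec, dotProduct]
    exact continuousOn_finsetSum _ fun j _ =>
      ((continuousOn_pi.1 (continuousOn_pi.1 h1 i) j)).mul continuousOn_const
  -- Beyond the row sums of `M`, the matrix `M - T I` maps the all-ones vector to a negative one, so
  -- the minimum principle applies.
  obtain ⟨T, hT0, hT⟩ : ∃ T : ℝ, 0 ≤ T ∧ ∀ i, M.mulVec 1 i < T := by
    obtain ⟨T, hT⟩ := (Set.finite_range fun i => M.mulVec 1 i).bddAbove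
    exact ⟨max 0 (T + 1), le_max_left _ _, fun i => lt_max_of_lt_right
      ((hT ⟨i, rfl⟩).trans_lt (lt_add_one T))⟩
  have huT : ∀ i, 0 ≤ u T i := by
    refine (hM.sub_smul_one T).nonneg_of_mulVec_nonpos (v := 1) (fun _ => one_pos) (fun i => ?_)
      (fun i => ?_)
    · rw [sub_smul_one_mulVec]; simpa using hT i
    · rw [sub_smul_one_mulVec]; linarith [hu T hT0 i]
  -- By `hpos` the path never touches the boundary of the nonnegative orthant: it stays in two
  -- disjoint open sets, the open orthant and the complement of the closed one, and connectedness
  -- forbids meeting both.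
  have hu0 : ∀ i, 0 < u 0 i := by
    by_contra hneg
    have hpc : IsPreconnected (Set.Icc 0 T) := isPreconnected_Icc
    have hc : ContinuousOn u (Set.Icc 0 T) := hcont.mono Set.Icc_subset_Ici_self
    have hopen : IsOpen {w : V → ℝ | ∀ i, 0 < w i} := by
      simp only [Set.ofPred_forall]
      exact isOpen_iInter_of_finite fun i => isOpen_lt continuous_const (continuous_apply i)
    have hclosed : IsClosed {w : V → ℝ | ∀ i, 0 ≤ w i} := by
      simp only [Set.ofPred_forall]
      exact isClosed_iInter fun i => isClosed_le continuous_const (continuous_apply i)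
    have hpi := hpc.image u hc
    obtain ⟨w, ⟨t, ht, rfl⟩, hw1, hw2⟩ := hpi _ _ hopen hclosed.isOpen_compl
      (by
        rintro _ ⟨t, ht, rfl⟩
        by_cases h : ∀ i, 0 ≤ u t i
        · exact Or.inl (hpos t ht.1 h)
        · exact Or.inr h)
      ⟨u T, ⟨T, ⟨hT0, le_rfl⟩, rfl⟩, hpos T hT0 huT⟩
      ⟨u 0, ⟨0, ⟨le_rfl, hT0⟩, rfl⟩, fun h => hneg (hpos 0 le_rfl h)⟩
    exact hw2 fun i => (hw1 i).le
  exact ⟨u 0, hu0, fun i => by linarith [hu 0 le_rfl i]⟩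

/-- This determinant is the characteristic polynomial at 0. Being monic, the polynomial cannot be
nonpositive there without having a root in `[0, ∞)`. -/
theorem IsHurwitz.det_neg_pos {M : Matrix V V ℝ} (hM : IsHurwitz M) : 0 < (-M).det := by
  have hdet := fun t ht => hM.det_smul_one_sub_ne_zero (t := t) ht
  have hev : ∀ t : ℝ, M.charpoly.eval t = (t • (1 : Matrix V V ℝ) - M).det := fun t => by
    rw [Matrix.eval_charpoly, Matrix.scalar_apply, ← Matrix.smul_one_eq_diagonal]
  by_contra hneg
  have h0 : M.charpoly.eval 0 ≤ 0 := by
    rw [hev, zero_smul, zero_sub]; exact not_lt.1 hneg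
  obtain ⟨T, hT0, hT⟩ : ∃ T : ℝ, 0 ≤ T ∧ 0 ≤ M.charpoly.eval T := by
    by_cases hd : 0 < M.charpoly.degree
    · have := M.charpoly.tendsto_atTop_of_leadingCoeff_nonneg hd
        (by rw [M.charpoly_monic.leadingCoeff]; exact zero_le_one)
      obtain ⟨T, h1, h2⟩ := ((eventually_ge_atTop (0 : ℝ)).and
        (this.eventually_ge_atTop 0)).exists
      exact ⟨T, h1, h2⟩
    · refine ⟨0, le_rfl, ?_⟩
      have := Polynomial.Monic.degree_le_zero_iff_eq_one M.charpoly_monic |>.1 (not_lt.1 hd)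
      simp [this]
  obtain ⟨t, ht, h⟩ := intermediate_value_Icc hT0 M.charpoly.continuous.continuousOn ⟨h0, hT⟩
  exact hdet t ht.1 (by rw [← hev]; exact h)

omit [Fintype V] [DecidableEq V] in
theorem IsMetzler.submatrix {W : Type*} {M : Matrix V V ℝ} (hM : IsMetzler M) {f : W → V}
    (hf : Function.Injective f) : IsMetzler (M.submatrix f f) :=
  fun _ _ hij => hM _ _ (hf.ne hij)

-- Restriction only drops nonnegative off-diagonal terms from each row sum.
omit [DecidableEq V] in
theorem IsMetzler.submatrix_mulVec_neg {W : Type*} [Fintype W] {M : Matrix V V ℝ}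
    (hM : IsMetzler M) {f : W → V} (hf : Function.Injective f) {v : V → ℝ} (hv : ∀ i, 0 < v i)
    (hMv : ∀ i, M.mulVec v i < 0) (i : W) : (M.submatrix f f).mulVec (v ∘ f) i < 0 := by
  refine lt_of_le_of_lt ?_ (hMv (f i))
  simp only [Matrix.mulVec, dotProduct, Matrix.submatrix_apply, Function.comp_apply]
  have hmap := Finset.sum_map Finset.univ ⟨f, hf⟩ (fun j => M (f i) j * v j)
  simp only [Function.Embedding.coeFn_mk] at hmap
  rw [← hmap]
  refine Finset.sum_le_sum_of_subset_of_nonneg (Finset.subset_univ _) fun j _ hj => ?_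
  refine mul_nonneg (hM _ _ fun h => hj ?_) (hv j).le
  exact Finset.mem_map.2 ⟨i, Finset.mem_univ i, h⟩

/-- If all leading principal minors of `-M` are positive, then the Metzler matrix `M` maps some
positive vector to a negative vector. -/
theorem IsMetzler.exists_mulVec_neg_of_leading_minors {n : ℕ} {M : Matrix (Fin n) (Fin n) ℝ}
    (hM : IsMetzler M)
    (hdet : ∀ (i : ℕ) (hi : i ≤ n), 0 < (-(leadingPrincipalSubmatrix M i hi)).det) :
    ∃ v : Fin n → ℝ, (∀ i, 0 < v i) ∧ ∀ i, M.mulVec v i < 0 := by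
  induction n with
  | zero => exact ⟨0, fun i => i.elim0, fun i => i.elim0⟩
  | succ n ih =>
    have hP : IsMetzler (M.submatrix Fin.castSucc Fin.castSucc) :=
      hM.submatrix (Fin.castSucc_injective n)
    obtain ⟨v, hv, hPv⟩ := ih hP (fun i hi => hdet i (hi.trans n.le_succ))
    have hd1 : 0 < (-M).det := hdet (n + 1) le_rfl
    have hd0 : 0 < (-(M.submatrix (Fin.castSucc (n := n)) Fin.castSucc)).det := hdet n n.le_succ
    -- The last adjugate column: `M w` vanishes except in the last coordinate, where it is `-det
    -- (-M)`, and the last entry of `w` is the preceding leading minor.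
    let w : Fin (n + 1) → ℝ := (-M).adjugate.mulVec (Pi.single (Fin.last n) 1)
    have hw : M.mulVec w = -(-M).det • Pi.single (Fin.last n) 1 := by
      have h : (-M).mulVec w = (-M).det • Pi.single (Fin.last n) 1 := by
        rw [Matrix.mulVec_mulVec, Matrix.mul_adjugate, Matrix.smul_mulVec, Matrix.one_mulVec]
      rw [Matrix.neg_mulVec] at h
      rw [neg_smul, ← h, neg_neg]
    have hwl : 0 < w (Fin.last n) := by
      have : w (Fin.last n) = (-M).adjugate (Fin.last n) (Fin.last n) := by
        simp [w]
      rw [this, Matrix.adjugate_fin_succ_eq_det_submatrix, Fin.succAbove_last, ← two_mul,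
        pow_mul, neg_one_sq, one_pow, one_mul]
      exact hd0
    have hws : ∀ i : Fin n, 0 ≤ w i.castSucc := by
      refine hP.nonneg_of_mulVec_nonpos hv hPv fun i => ?_
      have h := congrFun hw i.castSucc
      simp only [Matrix.mulVec, dotProduct, Fin.sum_univ_castSucc, Pi.smul_apply,
        Pi.single_eq_of_ne (Fin.castSucc_lt_last i).ne, smul_zero] at h
      simp only [Matrix.mulVec, dotProduct, Matrix.submatrix_apply]
      linarith [mul_nonneg (hM _ _ (Fin.castSucc_lt_last i).ne) hwl.le]
    let s : ℝ := ∑ j : Fin n, M (Fin.last n) j.castSucc * v j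
    have hs : 0 ≤ s := Finset.sum_nonneg fun j _ =>
      mul_nonneg (hM _ _ (Fin.castSucc_lt_last j).ne') (hv j).le
    -- Adding `ε` times `v`, extended by 0, makes the first `n` inequalities strict; this `ε` is
    -- small enough to keep the last one.
    let ε : ℝ := (-M).det / (s + 1)
    have hε : 0 < ε := div_pos hd1 (by linarith)
    have hεs : ε * s < (-M).det := by
      have : ε * (s + 1) = (-M).det := div_mul_cancel₀ _ (by linarith)
      linarith
    let v' : Fin (n + 1) → ℝ := Fin.snoc (α := fun _ => ℝ) v 0
    have hv'mul : ∀ i, M.mulVec v' i = ∑ j : Fin n, M i j.castSucc * v j := fun i => by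
      simp [v', Matrix.mulVec, dotProduct, Fin.sum_univ_castSucc]
    refine ⟨w + ε • v', fun i => ?_, fun i => ?_⟩
    · refine Fin.lastCases ?_ (fun i => ?_) i
      · simpa [v'] using hwl
      · simpa [v'] using add_pos_of_nonneg_of_pos (hws i) (mul_pos hε (hv i))
    · rw [Matrix.mulVec_add, Matrix.mulVec_smul, hw, Pi.add_apply, Pi.smul_apply, Pi.smul_apply,
        hv'mul, smul_eq_mul, smul_eq_mul]
      refine Fin.lastCases ?_ (fun i => ?_) i
      · rw [Pi.single_eq_same]
        change _ + ε * s < 0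
        linarith
      · rw [Pi.single_eq_of_ne (Fin.castSucc_lt_last i).ne, mul_zero, zero_add]
        exact mul_neg_of_pos_of_neg hε (hPv i)

end MetzlerGains
-- Signed sums over pairwise related subsets
namespace MetzlerGains

open Classical in
/-- The subsets of `U` whose members are pairwise related by `r`. -/
noncomputable def pairwiseSubsets {X : Type*} (r : X → X → Prop) (U : Finset X) :
    Finset (Finset X) :=
  U.powerset.filter fun S => (S : Set X).Pairwise r

theorem mem_pairwiseSubsets {X : Type*} {r : X → X → Prop} {U S : Finset X} :
    S ∈ pairwiseSubsets r U ↔ S ⊆ U ∧ (S : Set X).Pairwise r := by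
  simp [pairwiseSubsets]

/-- The signed sum, over the subsets of `U` whose members are pairwise related by `r`, of the
products of the weights `x`. -/
noncomputable def signedPairwiseSum {X : Type*} (r : X → X → Prop) (x : X → ℝ) (U : Finset X) : ℝ :=
  ∑ S ∈ pairwiseSubsets r U, (-1) ^ S.card * ∏ c ∈ S, x c

open Classical in
theorem pairwiseSubsets_insert {X : Type*} (r : X → X → Prop) [Std.Symm r] {a : X} {U : Finset X}
    (ha : a ∉ U) :
    pairwiseSubsets r (insert a U) =
      pairwiseSubsets r U ∪ (pairwiseSubsets r (U.filter (r a))).image (insert a) := by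
  have hins : ∀ S ⊆ U, ((insert a S : Finset X) : Set X).Pairwise r ↔
      (S : Set X).Pairwise r ∧ ∀ b ∈ S, r a b := fun S hS => by
    rw [Finset.coe_insert, Set.pairwise_insert_of_symm_of_notMem fun h => ha (hS h)]
    simp only [Finset.mem_coe]
  ext S
  simp only [Finset.mem_union, Finset.mem_image, mem_pairwiseSubsets]
  constructor
  · rintro ⟨h1, h2⟩
    by_cases haS : a ∈ S
    · right
      have hU : S.erase a ⊆ U := Finset.subset_insert_iff.1 h1
      rw [← Finset.insert_erase haS, hins _ hU] at h2
      exact ⟨S.erase a, ⟨fun b hb => Finset.mem_filter.2 ⟨hU hb, h2.2 b hb⟩, h2.1⟩,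
        Finset.insert_erase haS⟩
    · exact Or.inl ⟨(Finset.subset_insert_iff_of_notMem haS).1 h1, h2⟩
  · rintro (⟨h1, h2⟩ | ⟨T, ⟨h1, h2⟩, rfl⟩)
    · exact ⟨h1.trans (Finset.subset_insert _ _), h2⟩
    · have hT : T ⊆ U := h1.trans (Finset.filter_subset _ _)
      exact ⟨Finset.insert_subset_insert a hT,
        (hins T hT).2 ⟨h2, fun b hb => (Finset.mem_filter.1 (h1 hb)).2⟩⟩

-- Deletion recurrence, as for independence polynomials: a set omits `a`, or contains it and
-- otherwise only elements related to `a`.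
open Classical in
theorem signedPairwiseSum_insert {X : Type*} (r : X → X → Prop) [Std.Symm r] (x : X → ℝ) {a : X}
    {U : Finset X} (ha : a ∉ U) :
    signedPairwiseSum r x (insert a U) =
      signedPairwiseSum r x U - x a * signedPairwiseSum r x (U.filter (r a)) := by
  have hmem : ∀ S ∈ pairwiseSubsets r (U.filter (r a)), a ∉ S := fun S hS h =>
    ha (Finset.mem_filter.1 ((mem_pairwiseSubsets.1 hS).1 h)).1
  rw [signedPairwiseSum, pairwiseSubsets_insert r ha, Finset.sum_union, Finset.sum_image,
    sub_eq_add_neg]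
  · congr 1
    rw [signedPairwiseSum, Finset.mul_sum, ← Finset.sum_neg_distrib]
    refine Finset.sum_congr rfl fun S hS => ?_
    rw [Finset.card_insert_of_notMem (hmem S hS), Finset.prod_insert (hmem S hS)]
    ring
  · intro S hS T hT h
    rw [← Finset.erase_insert (hmem S hS), h, Finset.erase_insert (hmem T hT)]
  · refine Finset.disjoint_left.2 fun S hS hS' => ?_
    obtain ⟨T, -, rfl⟩ := Finset.mem_image.1 hS'
    exact ha ((mem_pairwiseSubsets.1 hS).1 (Finset.mem_insert_self a T))

/-- Both bounds go through the induction together: in the recurrence, the lower one needs the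
subtracted sum to be at most 1, the upper one needs it nonnegative. -/
theorem signedPairwiseSum_mem_Icc {X : Type*} (r : X → X → Prop) [Std.Symm r]
    {x : X → ℝ} (hx : ∀ c, 0 ≤ x c) (U : Finset X) (hU : ∑ c ∈ U, x c ≤ 1) :
    signedPairwiseSum r x U ∈ Set.Icc (1 - ∑ c ∈ U, x c) 1 := by
  classical
  induction U using Finset.strongInduction with
  | H U ih =>
    rcases U.eq_empty_or_nonempty with rfl | ⟨a, ha⟩
    · simp [signedPairwiseSum, pairwiseSubsets, Finset.filter_singleton]
    · have hcons : signedPairwiseSum r x U = signedPairwiseSum r x (U.erase a)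
          - x a * signedPairwiseSum r x ((U.erase a).filter (r a)) := by
        rw [← signedPairwiseSum_insert r x (Finset.notMem_erase a U), Finset.insert_erase ha]
      have hsum := Finset.add_sum_erase U x ha
      have hsum' : ∑ c ∈ (U.erase a).filter (r a), x c ≤ ∑ c ∈ U.erase a, x c :=
        Finset.sum_le_sum_of_subset_of_nonneg (Finset.filter_subset _ _) fun c _ _ => hx c
      have hxa := hx a
      obtain ⟨h1, h2⟩ := ih _ (Finset.erase_ssubset ha) (by linarith)
      obtain ⟨h3, h4⟩ := ih ((U.erase a).filter (r a))
        ((Finset.filter_subset _ _).trans_ssubset (Finset.erase_ssubset ha)) (by linarith)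
      have h5 : 0 ≤ signedPairwiseSum r x ((U.erase a).filter (r a)) := by linarith
      rw [hcons]
      constructor
      · nlinarith
      · nlinarith

/-! ### Permutation gains and the determinant -/

section Perm

open Equiv.Perm

variable {V : Type*} [Fintype V] [DecidableEq V]

/-- The product of the normalized entries of a matrix along the nontrivial orbits of a
permutation. -/
noncomputable def permGain (M : Matrix V V ℝ) (σ : Equiv.Perm V) : ℝ :=
  ∏ i ∈ σ.support, M (σ i) i / (-M (σ i) (σ i))

theorem permGain_nonneg {M : Matrix V V ℝ} (hM : IsMetzler M) (hD : ∀ i, M i i < 0)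
    (σ : Equiv.Perm V) : 0 ≤ permGain M σ :=
  Finset.prod_nonneg fun i hi => div_nonneg (hM _ _ (mem_support.1 hi)) (by linarith [hD (σ i)])

/-- The shift keeps the off-diagonal numerators and enlarges the denominators. -/
theorem permGain_sub_smul_one_le {M : Matrix V V ℝ} (hM : IsMetzler M) (hD : ∀ i, M i i < 0)
    {t : ℝ} (ht : 0 ≤ t) (σ : Equiv.Perm V) :
    permGain (M - t • (1 : Matrix V V ℝ)) σ ≤ permGain M σ := by
  have hentry : ∀ i ∈ σ.support, (M - t • (1 : Matrix V V ℝ)) (σ i) i = M (σ i) i := fun i hi => by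
    simp [mem_support.1 hi]
  have hdiag : ∀ i, (M - t • (1 : Matrix V V ℝ)) i i = M i i - t := fun i => by simp
  refine Finset.prod_le_prod (fun i hi => ?_) fun i hi => ?_
  · rw [hentry i hi, hdiag]
    exact div_nonneg (hM _ _ (mem_support.1 hi)) (by linarith [hD (σ i)])
  · rw [hentry i hi, hdiag]
    exact div_le_div_of_nonneg_left (hM _ _ (mem_support.1 hi)) (by linarith [hD (σ i)])
      (by linarith)

/-- A positive vector that a Metzler matrix maps to a negative vector bounds the gains. -/
theorem permGain_lt_one {M : Matrix V V ℝ} (hM : IsMetzler M) (hD : ∀ i, M i i < 0) {v : V → ℝ}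
    (hv : ∀ i, 0 < v i) (hMv : ∀ i, M.mulVec v i < 0) {σ : Equiv.Perm V} (hσ : σ ≠ 1) :
    permGain M σ < 1 := by
  -- Strict comparison of products needs positive factors, so a vanishing entry is treated apart.
  by_cases h0 : ∃ i ∈ σ.support, M (σ i) i = 0
  · obtain ⟨i, hi, h⟩ := h0
    rw [permGain, Finset.prod_eq_zero hi (by rw [h, zero_div])]
    exact one_pos
  push Not at h0
  have hlt : permGain M σ < ∏ i ∈ σ.support, v (σ i) / v i := by
    refine Finset.prod_lt_prod_of_nonempty (fun i hi => ?_) (fun i hi => ?_) ?_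
    · exact div_pos (lt_of_le_of_ne (hM _ _ (mem_support.1 hi)) (h0 i hi).symm)
        (by linarith [hD (σ i)])
    · rw [div_lt_div_iff₀ (by linarith [hD (σ i)]) (hv i)]
      have h := hMv (σ i)
      simp only [Matrix.mulVec, dotProduct] at h
      rw [← Finset.add_sum_erase _ _ (Finset.mem_univ (σ i))] at h
      have := Finset.single_le_sum (f := fun j => M (σ i) j * v j)
        (s := Finset.univ.erase (σ i)) (fun j hj => mul_nonneg
          (hM _ _ (Finset.ne_of_mem_erase hj).symm) (hv j).le)
        (Finset.mem_erase.2 ⟨(mem_support.1 hi).symm, Finset.mem_univ i⟩)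
      linarith
    · rwa [Finset.nonempty_iff_ne_empty, Ne, support_eq_empty_iff]
  refine hlt.trans_eq ?_
  rw [Finset.prod_div_distrib]
  have : ∏ i ∈ σ.support, v (σ i) = ∏ i ∈ σ.support, v i :=
    Finset.prod_equiv σ (fun i => by simp) fun i _ => rfl
  rw [this, div_self (Finset.prod_pos fun i _ => hv i).ne']

/-- The contribution of a permutation to a normalized determinant is multiplicative over its
cycle factors, and a cycle contributes the negative of its gain. -/
theorem sign_mul_prod_eq_prod_cycleFactors (b : V → V → ℝ) (σ : Equiv.Perm V) :
    ((sign σ : ℤ) : ℝ) * ∏ i ∈ σ.support, -b (σ i) i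
      = (-1) ^ σ.cycleFactorsFinset.card * ∏ c ∈ σ.cycleFactorsFinset, ∏ i ∈ c.support, b (c i) i := by
  induction σ using cycle_induction_on with
  | base_one => simp
  | base_cycles σ hσ =>
    rw [hσ.cycleFactorsFinset_eq_singleton, hσ.sign, Finset.prod_neg, Finset.prod_singleton,
      Finset.card_singleton]
    push_cast
    -- A cycle has sign `-(-1) ^ card`; the power cancels against the signs of the entries, leaving
    -- one minus sign.
    have h : ((-1 : ℝ) ^ σ.support.card) * (-1) ^ σ.support.card = 1 := by
      rw [← mul_pow]; simp
    linear_combination (-∏ i ∈ σ.support, b (σ i) i) * h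
  | induction_disjoint σ τ hd _ hσ hτ =>
    have hσi : ∏ i ∈ σ.support, -b ((σ * τ) i) i = ∏ i ∈ σ.support, -b (σ i) i :=
      Finset.prod_congr rfl fun i hi => by
        rw [mul_apply, notMem_support.1 (hd.mem_imp hi)]
    have hτi : ∏ i ∈ τ.support, -b ((σ * τ) i) i = ∏ i ∈ τ.support, -b (τ i) i :=
      Finset.prod_congr rfl fun i hi => by
        rw [hd.commute.eq, mul_apply, notMem_support.1 (hd.symm.mem_imp hi)]
    rw [hd.support_mul, Finset.prod_union hd.disjoint_support, hd.cycleFactorsFinset_mul_eq_union,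
      Finset.card_union_of_disjoint hd.disjoint_cycleFactorsFinset,
      Finset.prod_union hd.disjoint_cycleFactorsFinset, Equiv.Perm.sign_mul, hσi, hτi, pow_add]
    push_cast
    linear_combination (((sign τ : ℤ) : ℝ) * ∏ i ∈ τ.support, -b (τ i) i) * hσ
      + ((-1) ^ σ.cycleFactorsFinset.card *
        ∏ c ∈ σ.cycleFactorsFinset, ∏ i ∈ c.support, b (c i) i) * hτ

open Classical in
/-- The finite set of cyclic permutations. -/
noncomputable def cyclicPerms (V : Type*) [Fintype V] [DecidableEq V] : Finset (Equiv.Perm V) :=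
  Finset.univ.filter IsCycle

theorem mem_cyclicPerms {σ : Equiv.Perm V} : σ ∈ cyclicPerms V ↔ σ.IsCycle := by
  simp [cyclicPerms]

/-- Expansion of the determinant over the sets of pairwise disjoint cycles. -/
theorem det_neg_eq_prod_mul_signedPairwiseSum {A : Matrix V V ℝ} (hD : ∀ i, A i i ≠ 0) :
    (-A).det = (∏ i, -A i i) *
      signedPairwiseSum Equiv.Perm.Disjoint (permGain A) (cyclicPerms V) := by
  rw [Matrix.det_apply', signedPairwiseSum, Finset.mul_sum]
  refine Finset.sum_bij (fun σ _ => σ.cycleFactorsFinset) (fun σ _ => ?_)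
    (fun σ _ τ _ h => cycleFactorsFinset_injective h) (fun S hS => ?_) (fun σ _ => ?_)
  · exact mem_pairwiseSubsets.2 ⟨fun c hc => mem_cyclicPerms.2 (mem_cycleFactorsFinset_iff.1 hc).1,
      cycleFactorsFinset_pairwise_disjoint σ⟩
  · obtain ⟨hS1, hS2⟩ := mem_pairwiseSubsets.1 hS
    exact ⟨_, Finset.mem_univ _, cycleFactorsFinset_eq_finset.2
      ⟨fun c hc => mem_cyclicPerms.1 (hS1 hc), hS2, rfl⟩⟩
  · have h1 : ∏ i, (-A) (σ i) i = (∏ i, -A i i) *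
        ∏ i ∈ σ.support, -(A (σ i) i / (-A (σ i) (σ i))) := by
      have hite : ∏ i ∈ σ.support, -(A (σ i) i / (-A (σ i) (σ i)))
          = ∏ i, if i ∈ σ.support then -(A (σ i) i / (-A (σ i) (σ i))) else 1 := by
        rw [Finset.prod_ite_mem, Finset.univ_inter]
      -- Gains are normalized by the diagonal entry of the target row `σ i`, so the diagonal product
      -- is reindexed by `σ`.
      rw [← Equiv.prod_comp σ (fun i => -A i i), hite, ← Finset.prod_mul_distrib]
      refine Finset.prod_congr rfl fun i _ => ?_
      split_ifs with hi
      · have := hD (σ i)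
        rw [Matrix.neg_apply]
        field_simp
      · rw [notMem_support.1 hi, mul_one, Matrix.neg_apply]
    rw [h1]
    have h2 := sign_mul_prod_eq_prod_cycleFactors (fun i j => A i j / (-A i i)) σ
    simp only [permGain]
    rw [← h2]
    ring

end Perm

/-! ### Simple cycles as cyclic permutations -/

section SimpleCycle

open Equiv.Perm

variable {V : Type*} [Fintype V] [DecidableEq V]

/-- The cyclic permutation that sends every vertex of a simple cycle to the next one. -/
def SimpleCycle.toPerm {G : Digraph V} (c : SimpleCycle G) : Equiv.Perm V :=
  c.toCycle.formPerm c.nodup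

omit [Fintype V] in
theorem SimpleCycle.isCycle_toPerm {G : Digraph V} (c : SimpleCycle G) : c.toPerm.IsCycle :=
  c.toCycle.isCycle_formPerm c.nodup c.nontrivial

theorem SimpleCycle.support_toPerm {G : Digraph V} (c : SimpleCycle G) :
    c.toPerm.support = c.vertices :=
  c.toCycle.support_formPerm c.nodup c.nontrivial

theorem SimpleCycle.toPerm_injective {G : Digraph V} :
    Function.Injective (SimpleCycle.toPerm : SimpleCycle G → Equiv.Perm V) := by
  intro c d h
  apply SimpleCycle.toCycle_injective
  obtain ⟨s, -, hs⟩ := c.isCycle_toPerm.existsUnique_cycle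
  exact (hs _ ⟨c.nodup, rfl⟩).trans (hs _ ⟨d.nodup, h.symm⟩).symm

theorem SimpleCycle.disjoint_toPerm_iff {G : Digraph V} {c d : SimpleCycle G} :
    c.toPerm.Disjoint d.toPerm ↔ Disjoint c.vertices d.vertices := by
  rw [disjoint_iff_disjoint_support, c.support_toPerm, d.support_toPerm]

theorem permGain_toPerm (M : Matrix V V ℝ) (c : SimpleCycle (digraph M)) :
    permGain M c.toPerm = cycleGain M c := by
  rw [permGain, cycleGain, c.support_toPerm, ← Finset.prod_attach]
  refine Finset.prod_congr rfl fun i _ => ?_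
  have : c.toPerm i = c.next i :=
    c.toCycle.formPerm_apply_mem_eq_next c.nodup i.1 ((c.mem_vertices i.1).1 i.2)
  rw [this]

/-- A nonzero gain forces every entry along the orbit to be an edge. Thus cyclic permutations not
coming from the digraph contribute nothing to gain sums. -/
theorem exists_toPerm_eq {M : Matrix V V ℝ} {σ : Equiv.Perm V} (hσ : σ.IsCycle)
    (h0 : permGain M σ ≠ 0) : ∃ c : SimpleCycle (digraph M), c.toPerm = σ := by
  obtain ⟨⟨s, hn, ht⟩, rfl, -⟩ := hσ.existsUnique_cycle_nontrivial_subtype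
  refine ⟨⟨s, hn, ht, ?_⟩, rfl⟩
  have hedge : ∀ i ∈ s, M (s.formPerm hn i) i ≠ 0 := fun i hi h => h0 <| by
    refine Finset.prod_eq_zero (i := i) ?_ (by rw [h, zero_div])
    rw [Cycle.support_formPerm s hn ht]
    induction s using Quotient.inductionOn'
    exact List.mem_toFinset.2 hi
  clear h0 hσ ht
  induction s with
  | nil => trivial
  | cons a l _ =>
    rw [Cycle.chain_coe_cons, List.isChain_iff_getElem]
    intro i hi
    have hn' : (a :: l).Nodup := hn
    have hil : i < (a :: l).length := by simpa using hi
    have hx := hedge (a :: l)[i] (List.getElem_mem hil)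
    change M ((a :: l).formPerm (a :: l)[i]) _ ≠ 0 at hx
    rw [List.formPerm_apply_getElem _ hn' i hil] at hx
    change M _ _ ≠ 0
    have e1 : (a :: (l ++ [a]))[i] = (a :: l)[i] :=
      List.getElem_append_left (as := a :: l) (bs := [a]) hil
    rw [e1]
    convert hx using 2
    -- Either an inner edge, or the closing edge, where the index wraps around to 0.
    rcases Nat.lt_or_ge (i + 1) (a :: l).length with h | h
    · simp only [Nat.mod_eq_of_lt h]
      exact List.getElem_append_left (as := a :: l) (bs := [a]) h
    · have : i = l.length := by simp at h hil; omega
      subst this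
      simp
end SimpleCycle

end MetzlerGains
namespace MetzlerGains

/-! ### Total gain as a normalized determinant -/

section TotalGain

variable {V : Type*} [Fintype V] [DecidableEq V]

theorem sum_cycleGain (M : Matrix V V ℝ) :
    ∑ c : SimpleCycle (digraph M), cycleGain M c
      = ∑ σ ∈ cyclicPerms V, permGain M σ := by
  refine Finset.sum_of_injOn SimpleCycle.toPerm SimpleCycle.toPerm_injective.injOn
    (fun c _ => ?_) (fun σ hσ hn => ?_) (fun c _ => (permGain_toPerm M c).symm)
  · exact mem_cyclicPerms.2 c.isCycle_toPerm
  · by_contra h0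
    obtain ⟨c, hc⟩ := exists_toPerm_eq (mem_cyclicPerms.1 hσ) h0
    exact hn ⟨c, by simp, hc⟩

-- The leading 1 is the term of the empty set of cycles, and subtraction turns `(-1) ^ (ℓ - 1)` into
-- `(-1) ^ ℓ`.
open Classical in
theorem one_sub_totalCycleGain (M : Matrix V V ℝ) :
    1 - totalCycleGain M = signedPairwiseSum Equiv.Perm.Disjoint (permGain M)
      (cyclicPerms V) := by
  let P : Finset (SimpleCycle (digraph M)) → Prop := fun S =>
    ∀ c ∈ S, ∀ d ∈ S, c ≠ d → Disjoint c.vertices d.vertices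
  have hsplit : 1 - totalCycleGain M
      = ∑ S ∈ Finset.univ.filter P, (-1) ^ S.card * ∏ c ∈ S, cycleGain M c := by
    rw [← Finset.sum_fiberwise_of_maps_to (s := Finset.univ.filter P) (g := Finset.card)
      (t := Finset.range (Fintype.card (SimpleCycle (digraph M)) + 1))
      (fun S _ => Finset.mem_range_succ_iff.2 (Finset.card_le_univ S)),
      Finset.range_eq_Ico, Finset.sum_eq_sum_Ico_succ_bot (Nat.succ_pos _), sub_eq_add_neg]
    congr 1
    · rw [Finset.sum_eq_single_of_mem ∅ (by simp [P]) (fun S hS h => ?_)]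
      · simp
      · exact absurd (Finset.card_eq_zero.1 (Finset.mem_filter.1 hS).2) h
    · rw [totalCycleGain, ← Finset.sum_neg_distrib]
      refine Finset.sum_congr rfl fun ℓ hℓ => ?_
      rw [← Finset.sum_neg_distrib]
      refine Finset.sum_congr ?_ fun S hS => ?_
      · ext S
        simp only [disjointCycleSets, P, Finset.mem_filter, Finset.mem_powersetCard,
          Finset.mem_univ, Finset.subset_univ, true_and]
        refine and_comm.trans ?_
        congr!
      · have hc : S.card = ℓ := (Finset.mem_filter.1 hS).2
        obtain ⟨k, rfl⟩ : ∃ k, ℓ = k + 1 := ⟨ℓ - 1, by have := (Finset.mem_Icc.1 hℓ).1; omega⟩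
        rw [hc, Nat.add_sub_cancel, pow_succ]
        ring
  rw [hsplit, signedPairwiseSum]
  have hinj : Function.Injective (SimpleCycle.toPerm : SimpleCycle (digraph M) → Equiv.Perm V) :=
    SimpleCycle.toPerm_injective
  refine Finset.sum_of_injOn (Finset.image SimpleCycle.toPerm)
    (Finset.image_injective hinj).injOn (fun S hS => ?_) (fun T hT hn => ?_) (fun S _ => ?_)
  · have hP : P S := (Finset.mem_filter.1 hS).2
    refine Finset.mem_coe.2 (mem_pairwiseSubsets.2 ⟨fun σ hσ => ?_, ?_⟩)
    · obtain ⟨c, -, rfl⟩ := Finset.mem_image.1 hσ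
      exact mem_cyclicPerms.2 c.isCycle_toPerm
    · intro σ hσ τ hτ hne
      obtain ⟨c, hc, rfl⟩ := Finset.mem_image.1 (Finset.mem_coe.1 hσ)
      obtain ⟨d, hd, rfl⟩ := Finset.mem_image.1 (Finset.mem_coe.1 hτ)
      exact SimpleCycle.disjoint_toPerm_iff.2 (hP c hc d hd fun h => hne (congrArg _ h))
  · by_contra h0
    have hprod := Finset.prod_ne_zero_iff.1 (right_ne_zero_of_mul h0)
    obtain ⟨hT1, hT2⟩ := mem_pairwiseSubsets.1 hT
    refine hn ⟨Finset.univ.filter fun c => c.toPerm ∈ T, ?_, ?_⟩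
    · refine Finset.mem_coe.2 (Finset.mem_filter.2 ⟨Finset.mem_univ _, fun c hc d hd hne => ?_⟩)
      exact SimpleCycle.disjoint_toPerm_iff.1 (hT2 (Finset.mem_filter.1 hc).2
        (Finset.mem_filter.1 hd).2 (hinj.ne hne))
    · ext σ
      simp only [Finset.mem_image, Finset.mem_filter, Finset.mem_univ, true_and]
      constructor
      · rintro ⟨c, hc, rfl⟩
        exact hc
      · intro hσ
        obtain ⟨c, rfl⟩ := exists_toPerm_eq
          (mem_cyclicPerms.1 (hT1 hσ)) (hprod σ hσ)
        exact ⟨c, hσ, rfl⟩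
  · rw [Finset.card_image_of_injective _ hinj, Finset.prod_image hinj.injOn]
    simp only [permGain_toPerm]

/-- The total cycle gain as a normalized determinant. -/
theorem det_neg_eq_prod_mul_one_sub_totalCycleGain {A : Matrix V V ℝ} (hD : ∀ i, A i i ≠ 0) :
    (-A).det = (∏ i, -A i i) * (1 - totalCycleGain A) := by
  rw [det_neg_eq_prod_mul_signedPairwiseSum hD, one_sub_totalCycleGain]

theorem totalCycleGain_lt_one_iff {A : Matrix V V ℝ} (hD : ∀ i, A i i < 0) :
    totalCycleGain A < 1 ↔ 0 < (-A).det := by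
  rw [det_neg_eq_prod_mul_one_sub_totalCycleGain fun i => (hD i).ne,
    mul_pos_iff_of_pos_left (Finset.prod_pos fun i _ => neg_pos.2 (hD i)), sub_pos]

/-- If the cycle gains of a Metzler matrix with negative diagonal sum to less than one, the matrix
has no nonnegative real eigenvalue. -/
theorem IsMetzler.det_smul_one_sub_ne_zero {M : Matrix V V ℝ} (hM : IsMetzler M)
    (hD : ∀ i, M i i < 0) (hsum : ∑ c : SimpleCycle (digraph M), cycleGain M c < 1) {t : ℝ}
    (ht : 0 ≤ t) : (t • (1 : Matrix V V ℝ) - M).det ≠ 0 := by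
  classical
  have hMt := hM.sub_smul_one t
  have hDt : ∀ i, (M - t • (1 : Matrix V V ℝ)) i i < 0 := fun i => by
    simpa using (hD i).trans_le ht
  rw [sum_cycleGain] at hsum
  have hle : ∑ σ ∈ cyclicPerms V,
      permGain (M - t • (1 : Matrix V V ℝ)) σ < 1 :=
    (Finset.sum_le_sum fun σ _ => permGain_sub_smul_one_le hM hD ht σ).trans_lt hsum
  have : Std.Symm (Equiv.Perm.Disjoint (α := V)) := ⟨fun _ _ h => h.symm⟩
  have hpos := (signedPairwiseSum_mem_Icc Equiv.Perm.Disjoint (permGain_nonneg hMt hDt) _ hle.le).1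
  rw [← neg_sub M, det_neg_eq_prod_mul_signedPairwiseSum fun i => (hDt i).ne]
  exact (mul_pos (Finset.prod_pos fun i _ => neg_pos.2 (hDt i)) (by linarith)).ne'

end TotalGain

end MetzlerGains

theorem mainTheorem2 (n : ℕ) (M : Matrix (Fin n) (Fin n) ℝ)
    (hMetzler : MetzlerGains.IsMetzler M)
    (hIrr : MetzlerGains.IsIrreducible M)
    (hDiag : ∀ i, M i i < 0) :
    (MetzlerGains.IsHurwitz M →
      ∀ c : MetzlerGains.SimpleCycle (MetzlerGains.digraph M),
        MetzlerGains.cycleGain M c < 1) ∧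
    ((∑ c : MetzlerGains.SimpleCycle (MetzlerGains.digraph M),
        MetzlerGains.cycleGain M c) < 1 →
      MetzlerGains.IsHurwitz M) ∧
    (MetzlerGains.IsHurwitz M ↔
      ∀ (i : ℕ) (hi : i ≤ n), 1 ≤ i →
        MetzlerGains.totalCycleGain (MetzlerGains.leadingPrincipalSubmatrix M i hi) < 1) := by
  have hvec : MetzlerGains.IsHurwitz M →
      ∃ v : Fin n → ℝ, (∀ i, 0 < v i) ∧ ∀ i, M.mulVec v i < 0 := fun h =>
    hMetzler.exists_mulVec_neg hDiag fun _ ht => h.det_smul_one_sub_ne_zero ht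
  have hiff : ∀ (i : ℕ) (hi : i ≤ n),
      MetzlerGains.totalCycleGain (MetzlerGains.leadingPrincipalSubmatrix M i hi) < 1 ↔
        0 < (-(MetzlerGains.leadingPrincipalSubmatrix M i hi)).det := fun i hi =>
    MetzlerGains.totalCycleGain_lt_one_iff fun j => hDiag (Fin.castLE hi j)
  refine ⟨fun h c => ?_, fun h => ?_, fun h i hi _ => ?_, fun h => ?_⟩
  · obtain ⟨v, hv, hMv⟩ := hvec h
    rw [← MetzlerGains.permGain_toPerm]
    exact MetzlerGains.permGain_lt_one hMetzler hDiag hv hMv c.isCycle_toPerm.ne_one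
  · obtain ⟨v, hv, hMv⟩ := hMetzler.exists_mulVec_neg hDiag fun _ ht =>
      hMetzler.det_smul_one_sub_ne_zero hDiag h ht
    exact hMetzler.isHurwitz_of_mulVec_neg hv hMv
  · obtain ⟨v, hv, hMv⟩ := hvec h
    have hinj := Fin.castLE_injective hi
    rw [hiff]
    exact ((hMetzler.submatrix hinj).isHurwitz_of_mulVec_neg (fun j => hv (Fin.castLE hi j))
      (hMetzler.submatrix_mulVec_neg hinj hv hMv)).det_neg_pos
  · obtain ⟨v, hv, hMv⟩ := hMetzler.exists_mulVec_neg_of_leading_minors fun i hi => by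
      -- The bordering induction starts from the empty minor, which is 1.
      rcases Nat.eq_zero_or_pos i with rfl | hi0
      · simp
      · exact (hiff i hi).1 (h i hi hi0)
    exact hMetzler.isHurwitz_of_mulVec_neg hv hMv
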